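/- Let $d\ge 0$ be an integer and let $\Omega\subseteq\mathbb R^d$ be an open set with $0\in\Omega$ and $\Omega=-\Omega$, and let $z\in\Omega$. Let $\mathcal F(\Omega)$ be the set of functions $f:\mathbb R^d\to\mathbb R$ that are positive definite (that is, continuous and integrable, with Fourier transform $\widehat f(\xi)\ge 0$ for every $\xi\in\mathbb R^d$), whose closed support is contained in $\Omega$, and for which $f(0)=1$. Put $$\mathcal M(\Omega,z):=\sup_{f\in\mathcal F(\Omega)} f(z),\qquad \mathbb N_2:=\{2,3,4,\dots\},\qquad H(\Omega,z):=\{k\in\mathbb N_2 : kz\in\Omega,\ -kz\in\Omega\}.$$ Then: (i) if $H(\Omega,z)=\{n\}$ for some integer $n\ge 2$, then $\mathcal M(\Omega,z)=\dfrac{1}{2\cos\frac{\pi}{2n}}$; (ii) if $H(\Omega,z)=\mathbb N_2\setminus\{n\}$ for some integer $n\ge 2$, then $\mathcal M(\Omega,z)=\cos\dfrac{\pi}{2n}$; (iii) if $H(\Omega,z)=(n,\infty)\cap\mathbb N_2$ for some integer $n\ge 1$, then $\mathcal M(\Omega,z)=\dfrac{1}{2\cos\frac{\pi}{n+2}}$;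 (iv) if $H(\Omega,z)=\{3,5,7,\dots\}$, then $\mathcal M(\Omega,z)=\dfrac{2}{\pi}$; (v) if $H(\Omega,z)=\{2,4,6,\dots\}$, then $\mathcal M(\Omega,z)=\dfrac{\pi}{4}$. -/

import Mathlib

open scoped FourierTransform

/-- A function `f : ℝ^d → ℝ` is positive definite: it is continuous and integrable and its Fourier
transform `∫ exp (-2πi⟨x, ξ⟩) f x dx` is a nonnegative real number for every `ξ`. -/
structure IsPosDefFun {d : ℕ} (f : EuclideanSpace ℝ (Fin d) → ℝ) : Prop where
  continuous : Continuous f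
  integrable : MeasureTheory.Integrable f
  fourier_re_nonneg : ∀ ξ : EuclideanSpace ℝ (Fin d), 0 ≤ (𝓕 (fun x => (f x : ℂ)) ξ).re
  fourier_im_eq_zero : ∀ ξ : EuclideanSpace ℝ (Fin d), (𝓕 (fun x => (f x : ℂ)) ξ).im = 0

/-- The class `𝓕(Ω)` of positive definite functions `f : ℝ^d → ℝ` with (closed) support contained
in `Ω` and `f 0 = 1`. -/
def posDefClass {d : ℕ} (Ω : Set (EuclideanSpace ℝ (Fin d))) :
    Set (EuclideanSpace ℝ (Fin d) → ℝ) :=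
  {f | tsupport f ⊆ Ω ∧ f 0 = 1 ∧ IsPosDefFun f}

/-- The pointwise extremal quantity `𝓜(Ω, z)`, the supremum of `f z` over `f ∈ 𝓕(Ω)`.
A real supremum of an empty or unbounded set would be `0`, so an equation `𝓜(Ω, z) = v` with
`v ≠ 0` does say that `v` is the least upper bound of these values. -/
noncomputable def pointwiseExtremum {d : ℕ} (Ω : Set (EuclideanSpace ℝ (Fin d)))
    (z : EuclideanSpace ℝ (Fin d)) : ℝ :=
  sSup {y : ℝ | ∃ f ∈ posDefClass Ω, f z = y}

/-- The set `H(Ω, z)` of the integers `k ≥ 2` such that `kz` and `-kz` both lie in `Ω`. -/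
def multipleSet {d : ℕ} (Ω : Set (EuclideanSpace ℝ (Fin d)))
    (z : EuclideanSpace ℝ (Fin d)) : Set ℕ :=
  {k | 2 ≤ k ∧ (k : ℝ) • z ∈ Ω ∧ -((k : ℝ) • z) ∈ Ω}

open MeasureTheory Filter Topology Finset

/-! Only the values on the multiples of `z` matter. Restricting an admissible `f` gives a positive
definite sequence `a` on `ℤ` with `a 0 = 1` that vanishes at every `k ≥ 2` outside `H(Ω, z)`.
Conversely, Fejér means of such a sequence, spread over narrow positive definite bumps, give
admissible functions. So, for `z ≠ 0`, the extremum is a supremum of `a 1` over sequences.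

Upper bounds come from duality. If `a` and `c` have complementary supports beyond `1`, their product
is positive definite (Schur) and lives on `{0, ±1}`, so `a 1 * c 1 ≤ 1 / 2`. A pair attaining `1 /
2` solves both extremal problems at once: `cos (kπ/2n)` and a three-term cosine polynomial settle
(i) and (ii); the coefficients of the constant and of the cosine density on `[-π/2, π/2]` settle
(iv) and (v). Case (iii) is Fejér's inequality: a tridiagonal Toeplitz form tested on an
eigenvector, with a discrete extremal measure. -/

/-- A real sequence on `ℤ` is positive definite if it is even and all its Toeplitz forms are
nonnegative. -/
structure IsPosDefSeq (a : ℤ → ℝ) : Prop where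
  even : ∀ k, a (-k) = a k
  nonneg : ∀ (N : ℕ) (c : ℕ → ℝ),
    0 ≤ ∑ i ∈ range N, ∑ j ∈ range N, c i * c j * a ((i : ℤ) - (j : ℤ))

/-! ### Positive definite sequences and bounds on their value at `1` -/

namespace IsPosDefSeq

theorem cos_mul (θ : ℝ) : IsPosDefSeq fun k => Real.cos (k * θ) where
  even k := by simp
  nonneg N c := by
    have h : ∑ i ∈ range N, ∑ j ∈ range N,
        c i * c j * Real.cos ((((i : ℤ) - (j : ℤ) : ℤ) : ℝ) * θ) =
        (∑ i ∈ range N, c i * Real.cos (i * θ)) ^ 2 +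
        (∑ i ∈ range N, c i * Real.sin (i * θ)) ^ 2 := by
      rw [sq, sq, sum_mul_sum, sum_mul_sum, ← sum_add_distrib]
      refine sum_congr rfl fun i _ => ?_
      rw [← sum_add_distrib]
      refine sum_congr rfl fun j _ => ?_
      push_cast
      rw [sub_mul, Real.cos_sub]
      ring
    rw [h]
    positivity

theorem const_mul {a : ℤ → ℝ} (ha : IsPosDefSeq a) {r : ℝ} (hr : 0 ≤ r) :
    IsPosDefSeq fun k => r * a k where
  even k := by simp [ha.even]
  nonneg N c := by
    have := mul_nonneg hr (ha.nonneg N c)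
    rw [mul_sum] at this
    simp_rw [mul_sum] at this
    refine this.trans_eq (sum_congr rfl fun i _ => sum_congr rfl fun j _ => ?_)
    ring

theorem sum {ι : Type*} {s : Finset ι} {a : ι → ℤ → ℝ} (ha : ∀ m ∈ s, IsPosDefSeq (a m)) :
    IsPosDefSeq fun k => ∑ m ∈ s, a m k where
  even k := sum_congr rfl fun m hm => (ha m hm).even k
  nonneg N c := by
    have := sum_nonneg fun m hm => (ha m hm).nonneg N c
    rw [sum_comm] at this
    simp_rw [mul_sum]
    refine this.trans_eq (sum_congr rfl fun i _ => sum_comm)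

theorem of_tendsto {ι : Type*} {l : Filter ι} [l.NeBot] {a : ι → ℤ → ℝ} {b : ℤ → ℝ}
    (ha : ∀ᶠ m in l, IsPosDefSeq (a m)) (h : ∀ k, Tendsto (fun m => a m k) l (𝓝 (b k))) :
    IsPosDefSeq b where
  even k := tendsto_nhds_unique_of_eventuallyEq (h (-k)) (h k) (ha.mono fun _ hm => hm.even k)
  nonneg N c := ge_of_tendsto
    (tendsto_finsetSum _ fun _ _ => tendsto_finsetSum _ fun _ _ => (h _).const_mul _)
    (ha.mono fun _ hm => hm.nonneg N c)

/-- The easy half of Herglotz's theorem: a superposition of cosines with nonnegative weight. -/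
theorem integral {α : Type*} [MeasurableSpace α] {μ : Measure α} {w θ : α → ℝ}
    (hw : Integrable w μ) (hw0 : 0 ≤ᵐ[μ] w) (hθ : Measurable θ) :
    IsPosDefSeq fun k => ∫ x, w x * Real.cos (k * θ x) ∂μ where
  even k := by simp
  nonneg N c := by
    have hi : ∀ k : ℤ, Integrable (fun x => w x * Real.cos (k * θ x)) μ := fun k =>
      hw.mul_bdd (c := 1) (by fun_prop) (.of_forall fun x => Real.abs_cos_le_one _)
    have : ∑ i ∈ range N, ∑ j ∈ range N,
        c i * c j * ∫ x, w x * Real.cos ((((i : ℤ) - (j : ℤ) : ℤ) : ℝ) * θ x) ∂μ =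
        ∫ x, ∑ i ∈ range N, ∑ j ∈ range N,
          c i * c j * (w x * Real.cos ((((i : ℤ) - (j : ℤ) : ℤ) : ℝ) * θ x)) ∂μ := by
      rw [integral_finsetSum _ fun i _ => integrable_finsetSum _ fun j _ => (hi _).const_mul _]
      refine sum_congr rfl fun i _ => ?_
      rw [integral_finsetSum _ fun j _ => (hi _).const_mul _]
      exact sum_congr rfl fun j _ => (integral_const_mul _ _).symm
    rw [this]
    refine integral_nonneg_of_ae (hw0.mono fun x hx => ?_)
    exact ((cos_mul (θ x)).const_mul hx).nonneg N c

theorem posSemidef {a : ℤ → ℝ} (ha : IsPosDefSeq a) (N : ℕ) :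
    (Matrix.of fun i j : Fin N => a ((i : ℤ) - (j : ℤ))).PosSemidef := by
  refine Matrix.PosSemidef.of_dotProduct_mulVec_nonneg ?_ fun x => ?_
  · ext i j
    simp [← ha.even ((i : ℤ) - j)]
  · have h := ha.nonneg N fun i => if hi : i < N then x ⟨i, hi⟩ else 0
    simp_rw [Finset.sum_range] at h
    refine h.trans_eq ?_
    simp only [dotProduct, Matrix.mulVec, Matrix.of_apply, mul_sum]
    refine sum_congr rfl fun i _ => sum_congr rfl fun j _ => ?_
    simp only [Fin.is_lt, dite_true, Fin.eta, Pi.star_apply, star_trivial]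
    ring

/-- Schur product theorem: the Toeplitz matrix of a product is a Hadamard product. -/
theorem mul {a b : ℤ → ℝ} (ha : IsPosDefSeq a) (hb : IsPosDefSeq b) :
    IsPosDefSeq fun k => a k * b k where
  even k := by simp [ha.even, hb.even]
  nonneg N c := by
    have h := ((ha.posSemidef N).hadamard (hb.posSemidef N)).dotProduct_mulVec_nonneg
      fun i : Fin N => c i
    simp_rw [Finset.sum_range]
    refine h.trans_eq ?_
    simp only [dotProduct, Matrix.mulVec, Matrix.of_apply, mul_sum, Matrix.hadamard_apply]
    refine sum_congr rfl fun i _ => sum_congr rfl fun j _ => ?_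
    simp only [Pi.star_apply, star_trivial]
    ring

theorem sum_eq_tridiagonal {a : ℤ → ℝ} (ha : ∀ k, a (-k) = a k) (c : ℕ → ℝ) (N : ℕ)
    (h : ∀ k : ℕ, 2 ≤ k → k ≤ N → a k = 0) :
    ∑ i ∈ range (N + 1), ∑ j ∈ range (N + 1), c i * c j * a ((i : ℤ) - (j : ℤ)) =
      a 0 * ∑ i ∈ range (N + 1), c i ^ 2 + 2 * a 1 * ∑ i ∈ range N, c i * c (i + 1) := by
  induction N with
  | zero => simp; ring
  | succ N ih =>
    have hcross : ∑ i ∈ range (N + 1), c i * c (N + 1) * a ((N + 1 : ℕ) - (i : ℤ)) =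
        c N * c (N + 1) * a 1 := by
      rw [sum_range_succ, sum_eq_zero, zero_add]
      · simp
      · intro i hi
        have := h (N + 1 - i) (by grind) (by omega)
        rw [Nat.cast_sub (by grind)] at this
        rw [this, mul_zero]
    rw [sum_range_succ, sum_congr rfl fun i _ => sum_range_succ _ (N + 1), sum_add_distrib,
      ih fun k h2 hk => h k h2 (by omega), sum_range_succ _ (N + 1),
      sum_range_succ (fun i => c i ^ 2) (N + 1), sum_range_succ (fun i => c i * c (i + 1)) N,
      show ∑ i ∈ range (N + 1), c i * c (N + 1) * a ((i : ℤ) - (N + 1 : ℕ)) =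
        c N * c (N + 1) * a 1 from hcross ▸ sum_congr rfl fun i _ => by rw [← ha, neg_sub],
      show ∑ i ∈ range (N + 1), c (N + 1) * c i * a ((N + 1 : ℕ) - (i : ℤ)) =
        c N * c (N + 1) * a 1 from hcross ▸ sum_congr rfl fun i _ => by ring, sub_self]
    ring

/-- Two positive definite sequences, normalised at `0`, whose product vanishes beyond `1`. -/
theorem apply_one_mul_apply_one_le {a b : ℤ → ℝ} (ha : IsPosDefSeq a) (hb : IsPosDefSeq b)
    (ha0 : a 0 = 1) (hb0 : b 0 = 1) (h : ∀ k : ℕ, 2 ≤ k → a k * b k = 0) :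
    a 1 * b 1 ≤ 1 / 2 := by
  -- Alternating signs turn the form into `(N + 1) - 2 N a₁b₁`; letting `N` grow gives the bound.
  have key : ∀ N : ℕ, N * (2 * (a 1 * b 1) - 1) ≤ 1 := fun N => by
    have := (ha.mul hb).nonneg (N + 1) fun i => (-1) ^ i
    rw [sum_eq_tridiagonal (a := fun k => a k * b k) (ha.mul hb).even (fun i => (-1) ^ i) N
      fun k h2 _ => h k h2] at this
    have e1 : ∀ i : ℕ, ((-1 : ℝ) ^ i) ^ 2 = 1 := fun i => by rw [← pow_mul, mul_comm]; simp
    have e2 : ∀ i : ℕ, (-1 : ℝ) ^ i * (-1) ^ (i + 1) = -1 := fun i => by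
      rw [pow_succ, ← mul_assoc, ← sq, e1, one_mul]
    simp only [e1, e2, ha0, hb0, sum_const, card_range, nsmul_eq_mul] at this
    push_cast at this
    linarith
  by_contra! hlt
  obtain ⟨N, hN⟩ := exists_nat_gt (1 / (2 * (a 1 * b 1) - 1))
  rw [div_lt_iff₀ (by linarith)] at hN
  exact absurd (key N) (not_le.2 hN)

/-- The Fejér bound. -/
theorem apply_one_le_of_gap {a : ℤ → ℝ} (ha : IsPosDefSeq a) (ha0 : a 0 = 1) {n : ℕ} (hn : 1 ≤ n)
    (h : ∀ k : ℕ, 2 ≤ k → k ≤ n → a k = 0) :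
    a 1 ≤ 1 / (2 * Real.cos (Real.pi / ((n : ℝ) + 2))) := by
  set t := Real.pi / ((n : ℝ) + 2) with ht
  have hn' : (1 : ℝ) ≤ n := by exact_mod_cast hn
  have ht0 : 0 < t := by positivity
  have ht2 : t < Real.pi / 2 := div_lt_div_of_pos_left Real.pi_pos two_pos (by linarith)
  have hcos : 0 < Real.cos t := Real.cos_pos_of_mem_Ioo ⟨by linarith, ht2⟩
  have hmul : (n + 2) * t = Real.pi := by rw [ht]; field_simp
  set s : ℕ → ℝ := fun i => Real.sin (i * t) with hs
  -- Up to signs, `sin ((i + 1) t)` is the top eigenvector of the path on `n + 1` vertices, with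
  -- eigenvalue `2 cos t`. The signs make the form `(1 - 2 a₁ cos t) ∑ s²`.
  have h1 := ha.nonneg (n + 1) fun i => (-1) ^ i * s (i + 1)
  rw [sum_eq_tridiagonal ha.even _ n h, ha0] at h1
  have e1 : ∀ i : ℕ, ((-1 : ℝ) ^ i) ^ 2 = 1 := fun i => by rw [← pow_mul, mul_comm]; simp
  have e2 : ∀ i : ℕ, (-1 : ℝ) ^ i * s (i + 1) * ((-1) ^ (i + 1) * s (i + 1 + 1)) =
      - (s (i + 1) * s (i + 2)) := fun i => by
    linear_combination (-(s (i + 1) * s (i + 2))) * e1 i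
  simp only [e2, mul_pow, e1, one_mul, sum_neg_distrib] at h1
  have hA : 0 < ∑ i ∈ range (n + 1), s (i + 1) ^ 2 := by
    refine sum_pos' (fun i _ => sq_nonneg _) ⟨0, by simp, ?_⟩
    have : 0 < s (0 + 1) := by
      simpa [hs] using Real.sin_pos_of_pos_of_lt_pi ht0 (by linarith)
    positivity
  have hB : 2 * ∑ i ∈ range n, s (i + 1) * s (i + 2) =
      2 * Real.cos t * ∑ i ∈ range (n + 1), s (i + 1) ^ 2 := by
    -- The eigenvector recurrence; the choice of `t` gives the boundary values `s 0 = s (n + 2) =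
    -- 0`.
    have r : ∀ i : ℕ, 2 * Real.cos t * s (i + 1) ^ 2 =
        s (i + 1) * s (i + 2) + s i * s (i + 1) := fun i => by
      have p1 : s (i + 2) = s (i + 1) * Real.cos t + Real.cos ((i + 1 : ℕ) * t) * Real.sin t := by
        simp only [hs]; rw [← Real.sin_add]; congr 1; push_cast; ring
      have p2 : s i = s (i + 1) * Real.cos t - Real.cos ((i + 1 : ℕ) * t) * Real.sin t := by
        simp only [hs]; rw [← Real.sin_sub]; congr 1; push_cast; ring
      rw [p1, p2]; ring
    have z1 : s (n + 2) = 0 := by simp [hs, hmul]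
    have z0 : s 0 = 0 := by simp [hs]
    rw [mul_sum (range (n + 1)), sum_congr rfl fun i _ => r i, sum_add_distrib, sum_range_succ,
      sum_range_succ' (fun i => s i * s (i + 1)), z1, z0]
    ring
  rw [le_div_iff₀ (by positivity)]
  refine le_of_mul_le_mul_right ?_ hA
  linear_combination h1 - a 1 * hB

end IsPosDefSeq

/-! ### Positive definite functions on `ℝ^d` -/

section Fourier

variable {d : ℕ}

theorem IsPosDefFun.fourier_eq_ofReal {f : EuclideanSpace ℝ (Fin d) → ℝ} (hf : IsPosDefFun f)
    (ξ : EuclideanSpace ℝ (Fin d)) :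
    𝓕 (fun x => (f x : ℂ)) ξ = (((𝓕 (fun x => (f x : ℂ)) ξ).re : ℝ) : ℂ) :=
  Complex.ext rfl (hf.fourier_im_eq_zero ξ)

/-- Gaussian summability of the Fourier inversion integral. -/
theorem IsPosDefFun.tendsto_integral {f : EuclideanSpace ℝ (Fin d) → ℝ} (hf : IsPosDefFun f)
    (v : EuclideanSpace ℝ (Fin d)) :
    Tendsto (fun c : ℝ => ∫ w, Real.exp (-c⁻¹ * ‖w‖ ^ 2) * (𝓕 (fun x => (f x : ℂ)) w).re *
      Real.cos (2 * Real.pi * inner ℝ v w)) atTop (𝓝 (f v)) := by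
  have hi : Integrable fun x => (f x : ℂ) := hf.integrable.ofReal
  have h1 := Real.tendsto_integral_gaussian_smul' hi (v := v)
    (Complex.continuous_ofReal.comp hf.continuous).continuousAt
  have h2 := (Complex.continuous_re.tendsto _).comp h1
  simp only [Complex.ofReal_re] at h2
  refine h2.congr' ?_
  filter_upwards [Ioi_mem_atTop 0] with c (hc : 0 < c)
  have J : Integrable (fun w : EuclideanSpace ℝ (Fin d) =>
      Complex.exp (-(c : ℂ)⁻¹ * ‖w‖ ^ 2 + 2 * Real.pi * Complex.I * inner ℝ v w)) :=
    GaussianFourier.integrable_cexp_neg_mul_sq_norm_add (by simpa) _ _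
  -- Self-adjointness moves the transform from the Gaussian to `f`.
  have hself := VectorFourier.integral_fourierIntegral_smul_eq_flip (L := innerₗ _)
      Real.continuous_fourierChar continuous_inner J hi
  rw [flip_innerₗ] at hself
  have hL : ∫ w, ((Real.pi * c : ℂ) ^
      (Module.finrank ℝ (EuclideanSpace ℝ (Fin d)) / 2 : ℂ) *
      Complex.exp (-Real.pi ^ 2 * c * ‖v - w‖ ^ 2)) • (f w : ℂ) =
      ∫ w, 𝓕 (fun w => Complex.exp (-(c : ℂ)⁻¹ * ‖w‖ ^ 2 +
        2 * Real.pi * Complex.I * inner ℝ v w)) w • (f w : ℂ) := by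
    congr with w
    rw [fourier_gaussian_innerProductSpace' (by simpa)]
    rw [div_inv_eq_mul]
    congr 3
    rw [div_inv_eq_mul]
    ring
  have hR : ∫ w, Complex.exp (-(c : ℂ)⁻¹ * ‖w‖ ^ 2 + 2 * Real.pi * Complex.I * inner ℝ v w) •
      𝓕 (fun x => (f x : ℂ)) w = _ := hself.symm
  have hint : Integrable fun w => Complex.exp (-(c : ℂ)⁻¹ * ‖w‖ ^ 2 +
      2 * Real.pi * Complex.I * inner ℝ v w) • 𝓕 (fun x => (f x : ℂ)) w := by
    refine J.mul_bdd (c := ∫ x, ‖(f x : ℂ)‖) ?_ (.of_forall fun w => ?_)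
    · exact (VectorFourier.fourierIntegral_continuous Real.continuous_fourierChar
        (by exact continuous_inner) hi).aestronglyMeasurable
    · exact VectorFourier.norm_fourierIntegral_le_integral_norm _ _ _ _ _
  simp only [Function.comp_apply]
  rw [hL]
  refine (congrArg Complex.re hR.symm).trans ?_
  rw [show (∫ w, Complex.exp (-(c : ℂ)⁻¹ * ‖w‖ ^ 2 + 2 * Real.pi * Complex.I * inner ℝ v w) •
      𝓕 (fun x => (f x : ℂ)) w).re = _ from (integral_re hint).symm]
  refine integral_congr_ae (.of_forall fun w => ?_)
  simp only [smul_eq_mul, RCLike.re_eq_complex_re]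
  rw [hf.fourier_eq_ofReal w, Complex.re_mul_ofReal, Complex.exp_re, Complex.ofReal_re]
  have e1 : (-(c : ℂ)⁻¹ * ‖w‖ ^ 2 + 2 * Real.pi * Complex.I * inner ℝ v w).re =
      -c⁻¹ * ‖w‖ ^ 2 := by
    rw [show (-(c : ℂ)⁻¹ * ‖w‖ ^ 2 + 2 * Real.pi * Complex.I * (inner ℝ v w : ℝ) : ℂ) =
      ((-c⁻¹ * ‖w‖ ^ 2 : ℝ) : ℂ) + ((2 * Real.pi * inner ℝ v w : ℝ) : ℂ) * Complex.I by
        push_cast; ring]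
    simp only [Complex.add_re, Complex.ofReal_re, Complex.re_ofReal_mul, Complex.I_re]; ring
  have e2 : (-(c : ℂ)⁻¹ * ‖w‖ ^ 2 + 2 * Real.pi * Complex.I * inner ℝ v w).im =
      2 * Real.pi * inner ℝ v w := by
    rw [show (-(c : ℂ)⁻¹ * ‖w‖ ^ 2 + 2 * Real.pi * Complex.I * (inner ℝ v w : ℝ) : ℂ) =
      ((-c⁻¹ * ‖w‖ ^ 2 : ℝ) : ℂ) + ((2 * Real.pi * inner ℝ v w : ℝ) : ℂ) * Complex.I by
        push_cast; ring]
    simp only [Complex.add_im, Complex.ofReal_im, Complex.im_ofReal_mul, Complex.I_im]; ring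
  rw [e1, e2]
  ring

/-- A positive definite function restricted to the multiples of a point. -/
theorem IsPosDefFun.isPosDefSeq {f : EuclideanSpace ℝ (Fin d) → ℝ} (hf : IsPosDefFun f)
    (z : EuclideanSpace ℝ (Fin d)) : IsPosDefSeq fun k => f ((k : ℝ) • z) := by
  -- The transform of `f` is not known to be integrable, so inversion is used with a Gaussian
  -- cutoff: each cutoff gives a cosine integral with nonnegative weight, and `c → ∞` recovers `f`.
  refine .of_tendsto (l := atTop) (a := fun (c : ℝ) k => ∫ w : EuclideanSpace ℝ (Fin d),
    Real.exp (-c⁻¹ * ‖w‖ ^ 2) * (𝓕 (fun x => (f x : ℂ)) w).re *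
      Real.cos (k * (2 * Real.pi * inner ℝ z w))) ?_ fun k => ?_
  · filter_upwards [Ioi_mem_atTop 0] with c (hc : 0 < c)
    refine .integral ?_ (.of_forall fun w => mul_nonneg (Real.exp_nonneg _)
      (hf.fourier_re_nonneg w)) (by fun_prop)
    have hi : Integrable fun x => (f x : ℂ) := hf.integrable.ofReal
    have hcont : Continuous (𝓕 fun x => (f x : ℂ)) :=
      VectorFourier.fourierIntegral_continuous Real.continuous_fourierChar
        (by exact continuous_inner) hi
    refine Integrable.mul_bdd (c := ∫ x, ‖(f x : ℂ)‖) ?_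
      (Complex.continuous_re.comp hcont).aestronglyMeasurable (.of_forall fun w => ?_)
    · have := GaussianFourier.integrable_cexp_neg_mul_sq_norm_add
        (V := EuclideanSpace ℝ (Fin d)) (b := ((c⁻¹ : ℝ) : ℂ))
        (by simpa) 0 0
      refine this.norm.congr (.of_forall fun w => ?_)
      simp only [Complex.norm_exp]
      congr 1
      simp [← Complex.ofReal_pow]
    · exact (Complex.abs_re_le_norm _).trans
        (VectorFourier.norm_fourierIntegral_le_integral_norm _ _ _ _ _)
  · refine (hf.tendsto_integral ((k : ℝ) • z)).congr fun c => ?_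
    refine integral_congr_ae (.of_forall fun w => ?_)
    simp only [inner_smul_left, RCLike.conj_to_real]
    congr 2
    ring

theorem fourier_im_eq_zero_of_even {f : EuclideanSpace ℝ (Fin d) → ℝ} (hf : ∀ x, f (-x) = f x)
    (ξ : EuclideanSpace ℝ (Fin d)) : (𝓕 (fun x => (f x : ℂ)) ξ).im = 0 := by
  rw [← Complex.conj_eq_iff_im, Real.fourier_eq', ← integral_conj, ← integral_neg_eq_self]
  refine integral_congr_ae (.of_forall fun v => ?_)
  simp only [smul_eq_mul, map_mul, ← Complex.exp_conj, Complex.conj_ofReal, hf, Complex.conj_I,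
    inner_neg_left]
  congr 2
  push_cast
  ring

theorem fourier_comp_sub (f : EuclideanSpace ℝ (Fin d) → ℂ) (a ξ : EuclideanSpace ℝ (Fin d)) :
    𝓕 (fun x => f (x - a)) ξ = Complex.exp (↑(-2 * Real.pi * inner ℝ a ξ) * Complex.I) * 𝓕 f ξ := by
  have := congrFun (VectorFourier.fourierIntegral_comp_add_right Real.fourierChar volume
    (innerₗ (EuclideanSpace ℝ (Fin d))) f (-a)) ξ
  refine Eq.trans ?_ (this.trans ?_)
  · rfl
  · rw [Circle.smul_def, Real.fourierChar_apply, smul_eq_mul]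
    congr 3
    simp

/-- Take `ψ * ψ` for an even bump `ψ` of radius `r / 2`: the transform of `ψ` is real, so its square
is nonnegative. -/
theorem exists_isPosDefFun_tsupport_subset {r : ℝ} (hr : 0 < r) :
    ∃ φ : EuclideanSpace ℝ (Fin d) → ℝ, IsPosDefFun φ ∧ (∀ x, φ (-x) = φ x) ∧ φ 0 = 1 ∧
      tsupport φ ⊆ Metric.closedBall 0 r := by
  let ψ : ContDiffBump (0 : EuclideanSpace ℝ (Fin d)) := ⟨r / 4, r / 2, by linarith, by linarith⟩
  have hψc : HasCompactSupport ψ := ψ.hasCompactSupport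
  have hψi : Integrable ψ := ψ.integrable
  set L := ContinuousLinearMap.mul ℝ ℝ
  set φ : EuclideanSpace ℝ (Fin d) → ℝ := convolution ψ ψ L volume with hφ
  have hφx : ∀ x, φ x = ∫ t, ψ t * ψ (x - t) := fun x => rfl
  have hcont : Continuous φ :=
    hψc.continuous_convolution_right L hψi.locallyIntegrable ψ.continuous
  have hcs : HasCompactSupport φ := hψc.convolution L hψc
  have heven : ∀ x, φ (-x) = φ x := fun x => by
    rw [hφx, hφx, ← integral_neg_eq_self]
    refine integral_congr_ae (.of_forall fun t => ?_)
    simp only [ψ.neg]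
    rw [← ψ.neg (x - t)]
    congr 2
    abel
  have hpos : 0 < φ 0 := by
    rw [hφx]
    have hc : Continuous fun t => ψ t * ψ (0 - t) := by
      have := ψ.continuous
      fun_prop
    refine hc.integral_pos_of_hasCompactSupport_nonneg_nonzero hψc.mul_right
      (fun t => mul_nonneg ψ.nonneg ψ.nonneg) (x := 0) ?_
    have := ψ.one_of_mem_closedBall (x := 0) (Metric.mem_closedBall_self ψ.rIn_pos.le)
    simp [this]
  have hfour : ∀ ξ, 𝓕 (fun x => (φ x : ℂ)) ξ = 𝓕 (fun x => (ψ x : ℂ)) ξ ^ 2 := fun ξ => by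
    have hi : Integrable fun x => (ψ x : ℂ) := hψi.ofReal
    rw [sq, ← Real.fourier_mul_convolution_eq (R := ℂ) hi hi]
    refine congrArg (fun g : EuclideanSpace ℝ (Fin d) → ℂ => 𝓕 g ξ) (funext fun x => ?_)
    rw [hφx, ← integral_complex_ofReal]
    refine integral_congr_ae (.of_forall fun t => ?_)
    simp
  have him : ∀ ξ, (𝓕 (fun x => (ψ x : ℂ)) ξ).im = 0 := fourier_im_eq_zero_of_even ψ.neg
  have hdiv : ∀ ξ, 𝓕 (fun x => ((φ x / φ 0 : ℝ) : ℂ)) ξ =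
      (((φ 0)⁻¹ : ℝ) : ℂ) * 𝓕 (fun x => (φ x : ℂ)) ξ := fun ξ => by
    rw [Real.fourier_eq, Real.fourier_eq, ← integral_const_mul]
    refine integral_congr_ae (.of_forall fun v => ?_)
    simp only [Circle.smul_def, smul_eq_mul, div_eq_mul_inv]
    push_cast
    ring
  refine ⟨fun x => φ x / φ 0, ⟨by fun_prop, ?_, fun ξ => ?_, ?_⟩, fun x => by simp [heven],
    div_self hpos.ne', ?_⟩
  · exact (hcont.integrable_of_hasCompactSupport hcs).div_const _
  · rw [hdiv, hfour, Complex.re_ofReal_mul, sq, Complex.mul_re, him]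
    have := hpos.le
    simp only [mul_zero, sub_zero]
    exact mul_nonneg (by positivity) (mul_self_nonneg _)
  · exact fourier_im_eq_zero_of_even fun x => by simp [heven]
  · refine closure_minimal (fun x hx => ?_) Metric.isClosed_closedBall
    have hx' : x ∈ Function.support φ := fun h => hx (by simp [h])
    obtain ⟨y, hy, w, hw, rfl⟩ := support_convolution_subset L hx'
    rw [ψ.support_eq, mem_ball_zero_iff] at hy hw
    rw [mem_closedBall_zero_iff]
    have h1 : ‖y‖ < r / 2 := hy
    have h2 : ‖w‖ < r / 2 := hw
    linarith [norm_add_le y w]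

end Fourier

/-! ### Reduction of the extremal problem to sequences -/

section Extremum

variable {d : ℕ}

theorem exists_closedBall_subset_of_finset {X ι : Type*} [PseudoMetricSpace X] {U : Set X}
    (hU : IsOpen U) (s : Finset ι) (p : ι → X) (hp : ∀ k ∈ s, p k ∈ U) {R : ℝ} (hR : 0 < R) :
    ∃ r, 0 < r ∧ r < R ∧ ∀ k ∈ s, Metric.closedBall (p k) r ⊆ U := by
  have h : ∀ᶠ r in 𝓝[>] (0 : ℝ), ∀ k ∈ s, Metric.closedBall (p k) r ⊆ U := by
    rw [eventually_all_finset]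
    intro k hk
    obtain ⟨ε, hε, hsub⟩ := Metric.nhds_basis_closedBall.mem_iff.1 (hU.mem_nhds (hp k hk))
    filter_upwards [Ioo_mem_nhdsGT hε] with r hr
    exact (Metric.closedBall_subset_closedBall hr.2.le).trans hsub
  obtain ⟨r, h, hr⟩ := (h.and (Ioo_mem_nhdsGT hR)).exists
  exact ⟨r, hr.1, hr.2, h⟩

theorem fourier_sum_translates {ι : Type*} (s : Finset ι) (c : ι → ℝ)
    (a : ι → EuclideanSpace ℝ (Fin d)) {φ : EuclideanSpace ℝ (Fin d) → ℝ} (hφ : Integrable φ)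
    (ξ : EuclideanSpace ℝ (Fin d)) :
    𝓕 (fun x => ((∑ m ∈ s, c m * φ (x - a m) : ℝ) : ℂ)) ξ =
      ∑ m ∈ s, (c m : ℂ) * (Complex.exp (↑(-2 * Real.pi * inner ℝ (a m) ξ) * Complex.I) *
        𝓕 (fun x => (φ x : ℂ)) ξ) := by
  simp_rw [← fourier_comp_sub (fun x => (φ x : ℂ))]
  simp only [Real.fourier_eq, ← integral_const_mul]
  rw [← integral_finsetSum]
  · refine integral_congr_ae (.of_forall fun v => ?_)
    simp only [Circle.smul_def, smul_eq_mul, Complex.ofReal_sum, Complex.ofReal_mul, mul_sum]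
    exact sum_congr rfl fun m _ => by ring
  · intro m _
    refine Integrable.const_mul ?_ _
    exact (Real.fourierIntegral_convergent_iff ξ).2 (hφ.comp_sub_right (a m)).ofReal

/-- Attach the coefficient `b (i - j) / (N + 1)` to a bump at `(i - j) z`, over all `i, j ≤ N`.
Finitely many bumps fit into `Ω`, and the Fejér averaging keeps the transform nonnegative at the
cost of a factor `N / (N + 1)`. -/
theorem exists_mem_posDefClass_apply_eq {Ω : Set (EuclideanSpace ℝ (Fin d))}
    (hopen : IsOpen Ω) (hsymm : ∀ x ∈ Ω, -x ∈ Ω) (h0 : (0 : EuclideanSpace ℝ (Fin d)) ∈ Ω)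
    {z : EuclideanSpace ℝ (Fin d)} (hz : z ∈ Ω) (hz0 : z ≠ 0) {b : ℤ → ℝ} (hb : IsPosDefSeq b)
    (hb0 : b 0 = 1) (hsupp : ∀ k : ℕ, 2 ≤ k → k ∉ multipleSet Ω z → b k = 0) (N : ℕ) :
    ∃ f ∈ posDefClass Ω, f z = b 1 * (N / (N + 1)) := by
  have hmem : ∀ k : ℤ, b k ≠ 0 → (k : ℝ) • z ∈ Ω := by
    have hnat : ∀ k : ℕ, b k ≠ 0 → (k : ℝ) • z ∈ Ω := fun k hk => by
      rcases Nat.lt_or_ge k 2 with h | h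
      · interval_cases k <;> simpa
      · by_contra hcon
        exact hk (hsupp k h fun h' => hcon h'.2.1)
    intro k hk
    rcases Int.eq_nat_or_neg k with ⟨n, rfl | rfl⟩
    · simpa using hnat n hk
    · rw [hb.even] at hk
      simpa using hsymm _ (hnat n hk)
  -- With `r < ‖z‖` the bump vanishes at every nonzero multiple of `z`, so `f (k z)` sees only `b
  -- k`.
  obtain ⟨r, hr0, hrz, hball⟩ := exists_closedBall_subset_of_finset hopen
    ((Finset.Icc (-(N : ℤ)) N).filter fun k => b k ≠ 0) (fun k => (k : ℝ) • z)
    (fun k hk => hmem k (Finset.mem_filter.1 hk).2) (norm_pos_iff.2 hz0)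
  obtain ⟨φ, hφ, hφe, hφ0, hφs⟩ := exists_isPosDefFun_tsupport_subset (d := d) hr0
  have hφz : ∀ y, φ y ≠ 0 → ‖y‖ ≤ r := fun y hy =>
    mem_closedBall_zero_iff.1 (hφs (subset_tsupport _ hy))
  have hφk : ∀ k : ℤ, k ≠ 0 → φ ((k : ℝ) • z) = 0 := fun k hk => by
    by_contra hcon
    have h1 := hφz _ hcon
    rw [norm_smul] at h1
    have h2 : (1 : ℝ) ≤ ‖(k : ℝ)‖ := by
      rw [Real.norm_eq_abs]
      exact_mod_cast Int.one_le_abs hk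
    nlinarith [norm_nonneg z]
  set c : ℕ × ℕ → ℝ := fun p => b ((p.1 : ℤ) - (p.2 : ℤ)) / (N + 1) with hc
  set t : ℕ × ℕ → EuclideanSpace ℝ (Fin d) := fun p => (((p.1 : ℤ) - (p.2 : ℤ) : ℤ) : ℝ) • z with ht
  set s : Finset (ℕ × ℕ) := range (N + 1) ×ˢ range (N + 1) with hs
  set f : EuclideanSpace ℝ (Fin d) → ℝ := fun x => ∑ p ∈ s, c p * φ (x - t p) with hf
  have hfk : ∀ k : ℤ, f ((k : ℝ) • z) =
      ∑ p ∈ s, if (p.1 : ℤ) - (p.2 : ℤ) = k then b k / (N + 1) else 0 := fun k => by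
    refine sum_congr rfl fun p _ => ?_
    simp only [ht, hc]
    rw [← sub_smul, ← Int.cast_sub]
    split_ifs with h
    · simp [h, hφ0]
    · rw [hφk _ (by omega), mul_zero]
  have hfe : ∀ x, f (-x) = f x := fun x => by
    simp only [hf, hs, sum_product]
    rw [sum_comm]
    refine sum_congr rfl fun i _ => sum_congr rfl fun j _ => ?_
    simp only [hc, ht]
    rw [← hb.even, ← hφe, neg_sub]
    congr 2
    push_cast
    module
  refine ⟨f, ⟨?_, ?_, ?_, ?_, fun ξ => ?_, fourier_im_eq_zero_of_even hfe⟩, ?_⟩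
  · have hsub : Function.support f ⊆ ⋃ k ∈ (Finset.Icc (-(N : ℤ)) N).filter fun k => b k ≠ 0,
        Metric.closedBall ((k : ℝ) • z) r := fun x hx => by
      obtain ⟨p, hp, hne⟩ := exists_ne_zero_of_sum_ne_zero hx
      simp only [hs, mem_product, mem_range] at hp
      have h1 := left_ne_zero_of_mul hne
      have h2 := hφz _ (right_ne_zero_of_mul hne)
      simp only [Set.mem_iUnion]
      refine ⟨(p.1 : ℤ) - (p.2 : ℤ), ?_, by rwa [mem_closedBall_iff_norm]⟩
      refine Finset.mem_filter.2 ⟨Finset.mem_Icc.2 (by omega), fun h => h1 ?_⟩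
      simp only [hc, h, zero_div]
    refine (closure_minimal hsub ?_).trans (Set.iUnion₂_subset hball)
    exact Set.Finite.isClosed_biUnion (Finset.finite_toSet _)
      fun k _ => Metric.isClosed_closedBall
  · have := hfk 0
    simp only [Int.cast_zero, zero_smul] at this
    rw [this, hs, sum_product]
    have : ∀ i ∈ range (N + 1), ∑ j ∈ range (N + 1),
        (if (i : ℤ) - (j : ℤ) = 0 then b 0 / ((N : ℝ) + 1) else 0) = 1 / (N + 1) := fun i hi => by
      rw [sum_eq_single_of_mem i hi fun j _ hj => if_neg (by omega), if_pos (sub_self _), hb0]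
    rw [sum_congr rfl this, sum_const, card_range, nsmul_eq_mul]
    push_cast
    field_simp
  · have := hφ.continuous
    fun_prop
  · exact integrable_finsetSum _ fun p _ => (hφ.integrable.comp_sub_right _).const_mul _
  -- The transform of `f` is that of `φ`, divided by `N + 1`, times the Toeplitz form of `b k cos
  -- (kα)` at the all-ones vector.
  · have h1 := ((hb.mul (.cos_mul (-2 * Real.pi * inner ℝ z ξ))).nonneg (N + 1) fun _ => 1)
    rw [hf, fourier_sum_translates s c t hφ.integrable, Complex.re_sum]
    have h2 : ∀ p : ℕ × ℕ, ((c p : ℂ) *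
        (Complex.exp (↑(-2 * Real.pi * inner ℝ (t p) ξ) * Complex.I) *
        𝓕 (fun x => (φ x : ℂ)) ξ)).re = (𝓕 (fun x => (φ x : ℂ)) ξ).re / (N + 1) *
        (1 * 1 * (b ((p.1 : ℤ) - (p.2 : ℤ)) * Real.cos ((((p.1 : ℤ) - (p.2 : ℤ) : ℤ) : ℝ) *
          (-2 * Real.pi * inner ℝ z ξ)))) := fun p => by
      rw [Complex.re_ofReal_mul, Complex.mul_re, hφ.fourier_im_eq_zero, Complex.exp_ofReal_mul_I_re]
      simp only [hc, ht, inner_smul_left, RCLike.conj_to_real]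
      rw [show -2 * Real.pi * ((((p.1 : ℤ) - (p.2 : ℤ) : ℤ) : ℝ) * inner ℝ z ξ) =
        (((p.1 : ℤ) - (p.2 : ℤ) : ℤ) : ℝ) * (-2 * Real.pi * inner ℝ z ξ) by ring]
      ring
    rw [sum_congr rfl fun p _ => h2 p, ← mul_sum, hs, sum_product]
    exact mul_nonneg (div_nonneg (hφ.fourier_re_nonneg ξ) (by positivity)) h1
  · have := hfk 1
    simp only [Int.cast_one, one_smul] at this
    -- Exactly `N` pairs have difference `1`, those with `i ≥ 1`.
    rw [this, hs, sum_product, sum_range_succ']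
    have h1 : ∀ i ∈ range N, ∑ j ∈ range (N + 1),
        (if ((i + 1 : ℕ) : ℤ) - (j : ℤ) = 1 then b 1 / ((N : ℝ) + 1) else 0) =
        b 1 / (N + 1) := fun i hi => by
      rw [sum_eq_single_of_mem i (by simp at hi ⊢; omega) fun j _ hj => if_neg (by omega),
        if_pos (by push_cast; ring)]
    rw [sum_congr rfl h1, sum_eq_zero fun j _ => if_neg (by omega), sum_const, card_range,
      nsmul_eq_mul]
    ring

/-- The extremum is the value at `1` of an extremal positive definite sequence supported in the
admissible multiples. -/
theorem pointwiseExtremum_eq_of_isPosDefSeq {Ω : Set (EuclideanSpace ℝ (Fin d))}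
    (hopen : IsOpen Ω) (hsymm : ∀ x ∈ Ω, -x ∈ Ω) (h0 : (0 : EuclideanSpace ℝ (Fin d)) ∈ Ω)
    {z : EuclideanSpace ℝ (Fin d)} (hz : z ∈ Ω) (hz0 : z ≠ 0) {b : ℤ → ℝ} (hb : IsPosDefSeq b)
    (hb0 : b 0 = 1) (hsupp : ∀ k : ℕ, 2 ≤ k → k ∉ multipleSet Ω z → b k = 0)
    (hle : ∀ a : ℤ → ℝ, IsPosDefSeq a → a 0 = 1 →
      (∀ k : ℕ, 2 ≤ k → k ∉ multipleSet Ω z → a k = 0) → a 1 ≤ b 1) :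
    pointwiseExtremum Ω z = b 1 := by
  have hlub : IsLUB {y : ℝ | ∃ f ∈ posDefClass Ω, f z = y} (b 1) := by
    constructor
    · rintro _ ⟨f, ⟨hfs, hf0, hf⟩, rfl⟩
      have := hle _ (hf.isPosDefSeq z) (by simpa) fun k hk hkz => ?_
      · simpa using this
      · by_contra hne
        have hmem := hfs (subset_tsupport _ hne)
        exact hkz ⟨hk, by simpa using hmem, by simpa using hsymm _ hmem⟩
    · intro y hy
      have hlim : Tendsto (fun N : ℕ => b 1 * ((N : ℝ) / (N + 1))) atTop (𝓝 (b 1 * 1)) :=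
        tendsto_natCast_div_add_atTop (1 : ℝ) |>.const_mul _
      rw [mul_one] at hlim
      refine le_of_tendsto' hlim fun N => ?_
      obtain ⟨f, hf, hfz⟩ := exists_mem_posDefClass_apply_eq hopen hsymm h0 hz hz0 hb hb0 hsupp N
      exact hy ⟨f, hf, hfz⟩
  -- `N = 0` serves only to show that the set of values is nonempty.
  obtain ⟨f, hf, -⟩ := exists_mem_posDefClass_apply_eq hopen hsymm h0 hz hz0 hb hb0 hsupp 0
  exact hlub.csSup_eq ⟨_, f, hf, rfl⟩

/-- Duality: two sequences with complementary supports certify each other. -/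
theorem pointwiseExtremum_eq_of_dual {Ω : Set (EuclideanSpace ℝ (Fin d))}
    (hopen : IsOpen Ω) (hsymm : ∀ x ∈ Ω, -x ∈ Ω) (h0 : (0 : EuclideanSpace ℝ (Fin d)) ∈ Ω)
    {z : EuclideanSpace ℝ (Fin d)} (hz : z ∈ Ω) (hz0 : z ≠ 0) {b c : ℤ → ℝ} (hb : IsPosDefSeq b)
    (hb0 : b 0 = 1) (hsupp : ∀ k : ℕ, 2 ≤ k → k ∉ multipleSet Ω z → b k = 0)
    (hc : IsPosDefSeq c) (hc0 : c 0 = 1) (hcsupp : ∀ k ∈ multipleSet Ω z, c k = 0)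
    (hc1 : 0 < c 1) (hbc : b 1 * c 1 = 1 / 2) :
    pointwiseExtremum Ω z = b 1 := by
  refine pointwiseExtremum_eq_of_isPosDefSeq hopen hsymm h0 hz hz0 hb hb0 hsupp
    fun a ha ha0 hak => le_of_mul_le_mul_right ?_ hc1
  rw [hbc]
  refine ha.apply_one_mul_apply_one_le hc ha0 hc0 fun k hk => ?_
  by_cases hkz : k ∈ multipleSet Ω z
  · rw [hcsupp k hkz, mul_zero]
  · rw [hak k hk hkz, zero_mul]

theorem pointwiseExtremum_zero {Ω : Set (EuclideanSpace ℝ (Fin d))}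
    (hopen : IsOpen Ω) (h0 : (0 : EuclideanSpace ℝ (Fin d)) ∈ Ω) :
    pointwiseExtremum Ω 0 = 1 := by
  obtain ⟨r, hr, hsub⟩ := Metric.nhds_basis_closedBall.mem_iff.1 (hopen.mem_nhds h0)
  obtain ⟨φ, hφ, -, hφ0, hφs⟩ := exists_isPosDefFun_tsupport_subset (d := d) hr
  have : {y : ℝ | ∃ f ∈ posDefClass Ω, f 0 = y} = {1} :=
    Set.eq_singleton_iff_unique_mem.2
      ⟨⟨φ, ⟨hφs.trans hsub, hφ0, hφ⟩, hφ0⟩, fun _ ⟨_, hf, hy⟩ => hy ▸ hf.2.1⟩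
  rw [pointwiseExtremum, this, csSup_singleton]

end Extremum

/-! ### The extremal sequences -/

section Examples

theorem IsPosDefSeq.intervalIntegral {a b : ℝ} (hab : a ≤ b) {w : ℝ → ℝ} (hw : Continuous w)
    (hw0 : ∀ t ∈ Set.Icc a b, 0 ≤ w t) :
    IsPosDefSeq fun k => ∫ t in a..b, w t * Real.cos (k * t) := by
  simp only [intervalIntegral.integral_of_le hab]
  refine .integral (hw.integrableOn_Icc.mono_set Set.Ioc_subset_Icc_self) ?_ measurable_id
  exact (ae_restrict_iff' measurableSet_Ioc).2
    (.of_forall fun t ht => hw0 t (Set.Ioc_subset_Icc_self ht))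

theorem integral_cos_mul {k : ℝ} (hk : k ≠ 0) (α : ℝ) :
    ∫ t in -α..α, Real.cos (k * t) = 2 * Real.sin (k * α) / k := by
  rw [intervalIntegral.integral_comp_mul_left (fun t => Real.cos t) hk, integral_cos, mul_neg,
    Real.sin_neg, smul_eq_mul]
  field_simp
  ring

theorem integral_cos_mul_cos (m k α : ℝ) :
    ∫ t in -α..α, Real.cos (m * t) * Real.cos (k * t) =
      ((∫ t in -α..α, Real.cos ((m - k) * t)) + ∫ t in -α..α, Real.cos ((m + k) * t)) / 2 := by
  rw [← intervalIntegral.integral_add (Continuous.intervalIntegrable (by fun_prop) _ _)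
    (Continuous.intervalIntegrable (by fun_prop) _ _), ← intervalIntegral.integral_div]
  refine intervalIntegral.integral_congr fun t _ => ?_
  simp only [sub_mul, add_mul, Real.cos_sub, Real.cos_add]
  ring

theorem integral_cos_int_mul (k : ℤ) :
    ∫ t in -Real.pi..Real.pi, Real.cos (k * t) = if k = 0 then 2 * Real.pi else 0 := by
  split_ifs with h
  · simp [h, two_mul]
  · rw [integral_cos_mul (by exact_mod_cast h), Real.sin_int_mul_pi, mul_zero, zero_div]

theorem integral_cos_even_mul {k : ℤ} (hk : k ≠ 0) (he : Even k) :
    ∫ t in -(Real.pi / 2)..(Real.pi / 2), Real.cos (k * t) = 0 := by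
  obtain ⟨m, rfl⟩ := he
  rw [integral_cos_mul (by exact_mod_cast hk),
    show ((m + m : ℤ) : ℝ) * (Real.pi / 2) = m * Real.pi by push_cast; ring,
    Real.sin_int_mul_pi, mul_zero, zero_div]

/-! ### The sequences for the odd and for the even integers -/

/-- Cosine coefficients of the uniform density on `[-π/2, π/2]`. -/
theorem exists_isPosDefSeq_odd : ∃ b : ℤ → ℝ, IsPosDefSeq b ∧ b 0 = 1 ∧ b 1 = 2 / Real.pi ∧
    ∀ k : ℕ, 2 ≤ k → ¬ Odd k → b k = 0 := by
  have hpi := Real.pi_pos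
  refine ⟨_, .intervalIntegral (a := -(Real.pi / 2)) (b := Real.pi / 2) (by linarith)
    (w := fun _ => 1 / Real.pi) (by fun_prop) fun _ _ => by positivity, ?_, ?_, fun k hk ho => ?_⟩
  · simp
  · rw [intervalIntegral.integral_const_mul, integral_cos_mul (by norm_num)]
    simp; ring
  · rw [intervalIntegral.integral_const_mul, integral_cos_even_mul (by omega)
      (by exact_mod_cast Nat.not_odd_iff_even.1 ho), mul_zero]

/-- Cosine coefficients of the density `cos t / 2` on the same interval; the extra cosine shifts
frequencies by one and so exchanges parities. -/
theorem exists_isPosDefSeq_even : ∃ b : ℤ → ℝ, IsPosDefSeq b ∧ b 0 = 1 ∧ b 1 = Real.pi / 4 ∧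
    ∀ k : ℕ, 2 ≤ k → ¬ Even k → b k = 0 := by
  have hpi := Real.pi_pos
  refine ⟨_, .intervalIntegral (a := -(Real.pi / 2)) (b := Real.pi / 2) (by linarith)
    (w := fun t => 1 / 2 * Real.cos ((1 : ℤ) * t)) (by fun_prop) fun t ht => ?_, ?_, ?_,
    fun k hk ho => ?_⟩
  · have := Real.cos_nonneg_of_mem_Icc ht
    simp only [Int.cast_one, one_mul]
    positivity
  · simp
    norm_num
  · simp_rw [mul_assoc]
    rw [intervalIntegral.integral_const_mul, integral_cos_mul_cos, ← Int.cast_add,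
      integral_cos_even_mul (by norm_num) (by decide)]
    simp
    ring
  · have ho' : Odd (k : ℤ) := by exact_mod_cast Nat.not_even_iff_odd.1 ho
    simp_rw [mul_assoc]
    rw [intervalIntegral.integral_const_mul, integral_cos_mul_cos, ← Int.cast_add, ← Int.cast_sub,
      integral_cos_even_mul (by omega) (odd_one.add_odd ho'),
      integral_cos_even_mul (by omega) (odd_one.sub_odd ho')]
    simp

/-! ### The sequence vanishing at the integers from `2` to `n` -/

theorem sum_cos_odd_mul_eq_zero {N : ℕ} {t : ℝ} (ht : N * t = Real.pi) {k : ℕ} (hk0 : 0 < k)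
    (hkN : k < N) : ∑ m ∈ range N, Real.cos (k * ((2 * m + 1) * t + Real.pi)) = 0 := by
  have hN : (0 : ℝ) < N := by exact_mod_cast hk0.trans hkN
  have hpi := Real.pi_pos
  have ht0 : 0 < t := by
    by_contra! h
    nlinarith
  have hk0' : (0 : ℝ) < k := by exact_mod_cast hk0
  have hkN' : (k : ℝ) < N := by exact_mod_cast hkN
  have hs : 0 < Real.sin (k * t) :=
    Real.sin_pos_of_pos_of_lt_pi (by positivity) (by nlinarith)
  refine (mul_eq_zero.1 (?_ : 2 * Real.sin (k * t) * _ = 0)).resolve_left (by positivity)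
  have hterm : ∀ m : ℕ, 2 * Real.sin (k * t) * Real.cos (k * ((2 * m + 1) * t + Real.pi)) =
      Real.sin (k * (2 * (m + 1 : ℕ) * t + Real.pi)) - Real.sin (k * (2 * m * t + Real.pi)) := by
    intro m
    rw [Real.sin_sub_sin]
    congr 2
    · congr 1; push_cast; ring
    · push_cast; ring
  rw [mul_sum, sum_congr rfl fun m _ => hterm m,
    sum_range_sub fun m : ℕ => Real.sin (k * (2 * m * t + Real.pi)),
    show (k : ℝ) * (2 * N * t + Real.pi) = ((3 * k : ℕ) : ℝ) * Real.pi by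
      push_cast; rw [mul_assoc 2, ht]; ring,
    show (k : ℝ) * (2 * (0 : ℕ) * t + Real.pi) = (k : ℕ) * Real.pi by push_cast; ring,
    Real.sin_nat_mul_pi, Real.sin_nat_mul_pi, sub_zero]

/-- Use `n + 2` equally spaced nodes `η`, whose cosine sums vanish at frequencies `1, …, n + 1`,
with weights proportional to `1 + cos η / cos t`. The nodes nearest `π` are `π ± t`, where the
weight is exactly zero, so all weights are nonnegative. The factor `cos η` shifts frequencies by
one. -/
theorem exists_isPosDefSeq_gap {n : ℕ} (hn : 1 ≤ n) : ∃ b : ℤ → ℝ, IsPosDefSeq b ∧ b 0 = 1 ∧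
    b 1 = 1 / (2 * Real.cos (Real.pi / ((n : ℝ) + 2))) ∧
    ∀ k : ℕ, 2 ≤ k → k ≤ n → b k = 0 := by
  set t := Real.pi / ((n : ℝ) + 2) with ht
  have hpi := Real.pi_pos
  have hn' : (1 : ℝ) ≤ n := by exact_mod_cast hn
  have ht0 : 0 < t := by positivity
  have ht2 : t < Real.pi / 2 := div_lt_div_of_pos_left Real.pi_pos two_pos (by linarith)
  have hcos : 0 < Real.cos t := Real.cos_pos_of_mem_Ioo ⟨by linarith, ht2⟩
  have hmul : ((n + 2 : ℕ) : ℝ) * t = Real.pi := by rw [ht]; push_cast; field_simp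
  set η : ℕ → ℝ := fun m => (2 * m + 1) * t + Real.pi with hη
  have hw : ∀ m ∈ range (n + 2), 0 ≤ (1 + Real.cos (η m) / Real.cos t) / (n + 2) := fun m hm => by
    have hm' : (m : ℝ) + 1 ≤ (n + 2 : ℕ) := by exact_mod_cast mem_range.1 hm
    have hm0 : (0 : ℝ) ≤ m := m.cast_nonneg
    have hle : Real.cos ((2 * m + 1) * t) ≤ Real.cos t := by
      rcases le_total ((2 * m + 1) * t) Real.pi with h | h
      · exact Real.cos_le_cos_of_nonneg_of_le_pi ht0.le h (by nlinarith)
      · rw [← Real.cos_two_pi_sub]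
        exact Real.cos_le_cos_of_nonneg_of_le_pi ht0.le (by linarith) (by nlinarith)
    rw [hη, Real.cos_add_pi, neg_div]
    have := (div_le_one hcos).2 hle
    exact div_nonneg (by linarith) (by positivity)
  set S : ℕ → ℝ := fun k => ∑ m ∈ range (n + 2), Real.cos (k * η m) with hS
  have hS0 : S 0 = n + 2 := by simp [hS]
  have hSk : ∀ k : ℕ, 0 < k → k < n + 2 → S k = 0 := fun k => sum_cos_odd_mul_eq_zero hmul
  set b : ℤ → ℝ := fun k => ∑ m ∈ range (n + 2),
    (1 + Real.cos (η m) / Real.cos t) / (n + 2) * Real.cos (k * η m) with hb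
  have hbk : ∀ k : ℕ, b (k + 1 : ℕ) = (S (k + 1) + (S k + S (k + 2)) / (2 * Real.cos t)) / (n + 2) := by
    intro k
    simp only [hb, hS]
    rw [← sum_add_distrib, sum_div, ← sum_add_distrib, sum_div]
    refine sum_congr rfl fun m _ => ?_
    rw [show ((k : ℕ) : ℝ) * η m = ((k + 1 : ℕ) : ℝ) * η m - η m by push_cast; ring,
      show ((k + 2 : ℕ) : ℝ) * η m = ((k + 1 : ℕ) : ℝ) * η m + η m by push_cast; ring,
      Real.cos_add (_ * η m), Real.cos_sub (_ * η m), Int.cast_natCast]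
    field_simp
    ring
  refine ⟨b, .sum fun m hm => (IsPosDefSeq.cos_mul _).const_mul (hw m hm), ?_, ?_, fun k h2 hk => ?_⟩
  · have h1 := hSk 1 one_pos (by omega)
    simp only [hS, Nat.cast_one, one_mul] at h1
    simp only [hb, Int.cast_zero, zero_mul, Real.cos_zero, mul_one]
    rw [← sum_div, sum_add_distrib, ← sum_div, h1, zero_div, add_zero, sum_const, card_range,
      nsmul_one]
    push_cast
    exact div_self (by positivity)
  · have := hbk 0
    rw [hSk (0 + 1) (by omega) (by omega), hSk (0 + 2) (by omega) (by omega), hS0] at this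
    refine this.trans ?_
    field_simp
    ring
  · obtain ⟨k, rfl⟩ := Nat.exists_eq_add_of_le' (show 1 ≤ k by omega)
    rw [hbk, hSk _ (by omega) (by omega), hSk _ (by omega) (by omega),
      hSk _ (by omega) (by omega)]
    simp

/-! ### The sequence supported at `0`, `±1` and `±n` -/

/-- Monotonicity of `sin (n s) / sin s` without division, by induction through the addition formula.
-/
theorem sin_mul_sin_le {φ s : ℝ} (hs : 0 ≤ s) (hsφ : s ≤ φ) {n : ℕ} (hn : n * φ ≤ Real.pi / 2) :
    Real.sin (n * φ) * Real.sin s ≤ Real.sin (n * s) * Real.sin φ := by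
  have hpi := Real.pi_pos
  induction n with
  | zero => simp
  | succ n ih =>
    push_cast at hn ⊢
    have hn0 : (0 : ℝ) ≤ n := n.cast_nonneg
    have h0 : 0 ≤ n * φ := mul_nonneg hn0 (hs.trans hsφ)
    have hns : n * s ≤ n * φ := mul_le_mul_of_nonneg_left hsφ hn0
    have hns0 : 0 ≤ n * s := mul_nonneg hn0 hs
    have hih := ih (by nlinarith)
    have c1 : Real.cos φ ≤ Real.cos s :=
      Real.cos_le_cos_of_nonneg_of_le_pi hs (by nlinarith) hsφ
    have c2 : Real.cos (n * φ) ≤ Real.cos (n * s) :=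
      Real.cos_le_cos_of_nonneg_of_le_pi hns0 (by nlinarith) hns
    have s1 : 0 ≤ Real.sin s := Real.sin_nonneg_of_nonneg_of_le_pi hs (by nlinarith)
    have s2 : 0 ≤ Real.sin φ := Real.sin_nonneg_of_nonneg_of_le_pi (by linarith) (by nlinarith)
    have s3 : 0 ≤ Real.sin (n * s) := Real.sin_nonneg_of_nonneg_of_le_pi hns0 (by nlinarith)
    have c3 : 0 ≤ Real.cos φ := Real.cos_nonneg_of_mem_Icc ⟨by linarith, by nlinarith⟩
    rw [add_mul, add_mul, one_mul, one_mul, Real.sin_add, Real.sin_add]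
    have m1 := mul_le_mul_of_nonneg_right hih c3
    have m2 := mul_le_mul_of_nonneg_left c1 (mul_nonneg s3 s2)
    have m3 := mul_le_mul_of_nonneg_left c2 (mul_nonneg s2 s1)
    linarith

/-- The coefficient `sin θ / n` makes `θ` a double zero. The function decreases before `θ` and
increases up to `π / 2`; beyond, `-cos s ≥ 0` and `sin θ / n ≤ cos θ` suffice. -/
theorem cos_sub_cos_add_nonneg_of_mem_Icc {n : ℕ} (hn : 2 ≤ n) {θ : ℝ}
    (hθ : n * θ = Real.pi / 2) {s : ℝ} (hs : s ∈ Set.Icc 0 Real.pi) :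
    0 ≤ Real.cos θ - Real.cos s + Real.sin θ / n * Real.cos (n * s) := by
  have hpi := Real.pi_pos
  have hn' : (2 : ℝ) ≤ n := by exact_mod_cast hn
  have hθ0 : 0 < θ := by
    by_contra! h
    nlinarith
  have hθ4 : θ ≤ Real.pi / 4 := by nlinarith
  have hsin : 0 ≤ Real.sin θ := Real.sin_nonneg_of_nonneg_of_le_pi hθ0.le (by linarith)
  set F : ℝ → ℝ := fun s => Real.cos θ - Real.cos s + Real.sin θ / n * Real.cos (n * s) with hF
  have hFc : Continuous F := by fun_prop
  have hFd : ∀ s, HasDerivAt F (Real.sin s - Real.sin θ * Real.sin (n * s)) s := fun s => by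
    have h1 := ((hasDerivAt_id s).const_mul (n : ℝ)).cos.const_mul (Real.sin θ / n)
    have h2 := ((hasDerivAt_const s (Real.cos θ)).sub (Real.hasDerivAt_cos s)).add h1
    refine h2.congr_deriv ?_
    simp only [id]
    field_simp
    ring
  have hFθ : F θ = 0 := by simp [hF, hθ]
  rcases le_total s θ with h | h
  · have hanti : AntitoneOn F (Set.Icc 0 θ) := by
      refine antitoneOn_of_deriv_nonpos (convex_Icc _ _) hFc.continuousOn
        (fun x _ => (hFd x).differentiableAt.differentiableWithinAt) fun x hx => ?_
      rw [interior_Icc] at hx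
      rw [(hFd x).deriv]
      have := sin_mul_sin_le hx.1.le hx.2.le (n := n) hθ.le
      rw [hθ, Real.sin_pi_div_two] at this
      linarith
    exact hFθ.symm.le.trans (hanti ⟨hs.1, h⟩ ⟨hθ0.le, le_rfl⟩ h)
  · rcases le_total s (Real.pi / 2) with h' | h'
    · have hmono : MonotoneOn F (Set.Icc θ (Real.pi / 2)) := by
        refine monotoneOn_of_deriv_nonneg (convex_Icc _ _) hFc.continuousOn
          (fun x _ => (hFd x).differentiableAt.differentiableWithinAt) fun x hx => ?_
        rw [interior_Icc] at hx
        rw [(hFd x).deriv]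
        have h1 := Real.sin_le_sin_of_le_of_le_pi_div_two (by linarith) hx.2.le hx.1.le
        have h2 := mul_le_mul_of_nonneg_left (Real.sin_le_one (n * x)) hsin
        linarith
      exact hFθ.symm.le.trans (hmono ⟨le_rfl, by linarith⟩ ⟨h, h'⟩ h)
    · have h1 : Real.cos s ≤ 0 := Real.cos_nonpos_of_pi_div_two_le_of_le h' (by linarith [hs.2])
      have h2 : Real.sin θ ≤ Real.cos θ := by
        rw [← Real.sin_pi_div_two_sub]
        exact Real.sin_le_sin_of_le_of_le_pi_div_two (by linarith) (by linarith) (by linarith)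
      have h3 : Real.sin θ / n ≤ Real.sin θ := div_le_self hsin (by linarith)
      have h4 := mul_le_mul_of_nonneg_left (Real.neg_one_le_cos (n * s))
        (show 0 ≤ Real.sin θ / n by positivity)
      linarith

theorem cos_sub_cos_add_nonneg {n : ℕ} (hn : 2 ≤ n) {θ : ℝ} (hθ : n * θ = Real.pi / 2) (s : ℝ) :
    0 ≤ Real.cos θ - Real.cos s + Real.sin θ / n * Real.cos (n * s) := by
  have h := cos_sub_cos_add_nonneg_of_mem_Icc hn hθ
    ⟨Real.arccos_nonneg (Real.cos s), Real.arccos_le_pi _⟩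
  -- `cos (n s)` is a polynomial in `cos s`, so `s` may be replaced by `arccos (cos s)` in `[0, π]`.
  have hT : ∀ x : ℝ, Real.cos (n * x) = (Polynomial.Chebyshev.T ℝ n).eval (Real.cos x) :=
    fun x => by simp
  rwa [hT, Real.cos_arccos (Real.neg_one_le_cos s) (Real.cos_le_one s), ← hT] at h

theorem exists_isPosDefSeq_singleton {n : ℕ} (hn : 2 ≤ n) : ∃ b : ℤ → ℝ, IsPosDefSeq b ∧ b 0 = 1 ∧
    b 1 = 1 / (2 * Real.cos (Real.pi / (2 * (n : ℝ)))) ∧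
    ∀ k : ℕ, 2 ≤ k → k ≠ n → b k = 0 := by
  set θ := Real.pi / (2 * (n : ℝ)) with hθ
  have hpi := Real.pi_pos
  have hn' : (2 : ℝ) ≤ n := by exact_mod_cast hn
  have hmul : n * θ = Real.pi / 2 := by rw [hθ]; field_simp
  have hθ0 : 0 < θ := by positivity
  have hcos : 0 < Real.cos θ := Real.cos_pos_of_mem_Ioo ⟨by linarith, by nlinarith⟩
  set w : ℝ → ℝ := fun t => (1 + 1 / Real.cos θ * Real.cos t +
    (-1) ^ n * (Real.tan θ / n) * Real.cos (n * t)) / (2 * Real.pi) with hw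
  have hw0 : ∀ t, 0 ≤ w t := fun t => by
    -- The shift by `π` makes the coefficient of `cos t` positive and creates the sign `(-1) ^ n`.
    have h := cos_sub_cos_add_nonneg hn hmul (t + Real.pi)
    rw [mul_add, Real.cos_add_nat_mul_pi, Real.cos_add_pi] at h
    have h' := div_nonneg h hcos.le
    refine div_nonneg (h'.trans_eq ?_) (by positivity)
    rw [Real.tan_eq_sin_div_cos]
    field_simp
    ring
  set I : ℤ → ℝ := fun k => if k = 0 then 2 * Real.pi else 0 with hI
  have hJ : ∀ m k : ℤ, ∫ t in -Real.pi..Real.pi, Real.cos (m * t) * Real.cos (k * t) =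
      (I (m - k) + I (m + k)) / 2 := fun m k => by
    rw [integral_cos_mul_cos, ← Int.cast_add, ← Int.cast_sub, integral_cos_int_mul,
      integral_cos_int_mul]
  have hb : ∀ k : ℤ, ∫ t in -Real.pi..Real.pi, w t * Real.cos (k * t) =
      (I k + 1 / Real.cos θ * ((I (1 - k) + I (1 + k)) / 2) +
        (-1) ^ n * (Real.tan θ / n) * ((I (n - k) + I (n + k)) / 2)) / (2 * Real.pi) := fun k => by
    rw [← hJ, ← hJ, ← show _ = I k from integral_cos_int_mul k,
      ← intervalIntegral.integral_const_mul, ← intervalIntegral.integral_const_mul,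
      ← intervalIntegral.integral_add (Continuous.intervalIntegrable (by fun_prop) _ _)
        (Continuous.intervalIntegrable (by fun_prop) _ _),
      ← intervalIntegral.integral_add (Continuous.intervalIntegrable (by fun_prop) _ _)
        (Continuous.intervalIntegrable (by fun_prop) _ _), ← intervalIntegral.integral_div]
    refine intervalIntegral.integral_congr fun t _ => ?_
    simp only [hw, Int.cast_one, one_mul, Int.cast_natCast]
    ring
  have hI0 : ∀ k : ℤ, k ≠ 0 → I k = 0 := fun k hk => if_neg hk
  have hI1 : I 0 = 2 * Real.pi := if_pos rfl
  refine ⟨_, .intervalIntegral (a := -Real.pi) (b := Real.pi) (by linarith) (w := w)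
    (by fun_prop) fun t _ => hw0 t, ?_, ?_, fun k hk hkn => ?_⟩
  · rw [hb, hI1, hI0 (1 - 0) (by omega), hI0 (1 + 0) (by omega), hI0 (n - 0) (by omega),
      hI0 (n + 0) (by omega)]
    field_simp
    ring
  · rw [hb, sub_self, hI1, hI0 1 (by omega), hI0 (1 + 1) (by omega), hI0 (n - 1) (by omega),
      hI0 (n + 1) (by omega)]
    field_simp
    ring
  · rw [hb, hI0 k (by omega), hI0 (1 - k) (by omega), hI0 (1 + k) (by omega),
      hI0 (n - k) (by omega), hI0 (n + k) (by omega)]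
    simp

end Examples

/-! ### The five cases -/

theorem mainTheorem5 (d : ℕ) (Ω : Set (EuclideanSpace ℝ (Fin d)))
    (hopen : IsOpen Ω) (hsymm : ∀ x ∈ Ω, -x ∈ Ω) (h0 : (0 : EuclideanSpace ℝ (Fin d)) ∈ Ω)
    (z : EuclideanSpace ℝ (Fin d)) (hz : z ∈ Ω) :
    (∀ n : ℕ, 2 ≤ n → multipleSet Ω z = {n} →
      pointwiseExtremum Ω z = 1 / (2 * Real.cos (Real.pi / (2 * (n : ℝ))))) ∧
    (∀ n : ℕ, 2 ≤ n → multipleSet Ω z = {k : ℕ | 2 ≤ k ∧ k ≠ n} →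
      pointwiseExtremum Ω z = Real.cos (Real.pi / (2 * (n : ℝ)))) ∧
    (∀ n : ℕ, 1 ≤ n → multipleSet Ω z = {k : ℕ | 2 ≤ k ∧ n < k} →
      pointwiseExtremum Ω z = 1 / (2 * Real.cos (Real.pi / ((n : ℝ) + 2)))) ∧
    (multipleSet Ω z = {k : ℕ | 2 ≤ k ∧ Odd k} →
      pointwiseExtremum Ω z = 2 / Real.pi) ∧
    (multipleSet Ω z = {k : ℕ | 2 ≤ k ∧ Even k} →
      pointwiseExtremum Ω z = Real.pi / 4) := by
  have hpi := Real.pi_pos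
  rcases eq_or_ne z 0 with rfl | hz0
  -- For `z = 0` every `k ≥ 2` is admissible, which only (iii) with `n = 1` allows; there `1 / (2
  -- cos (π/3)) = 1`.
  · have hall : ∀ k, 2 ≤ k → k ∈ multipleSet Ω 0 := fun k hk => by simp [multipleSet, hk, h0]
    refine ⟨fun n hn h => ?_, fun n hn h => ?_, fun n hn h => ?_, fun h => ?_, fun h => ?_⟩
    · have := hall (n + 1) (by omega)
      simp [h] at this
    · have := hall n hn
      simp [h] at this
    · obtain rfl : n = 1 := by
        by_contra hne
        have := hall n (by omega)
        simp [h] at this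
      rw [pointwiseExtremum_zero hopen h0, Nat.cast_one, show (1 : ℝ) + 2 = 3 by norm_num,
        Real.cos_pi_div_three]
      norm_num
    · have := hall 2 le_rfl
      rw [h] at this
      exact absurd this.2 (by decide)
    · have := hall 3 (by omega)
      rw [h] at this
      exact absurd this.2 (by decide)
  -- This sequence vanishes at `n`: it is the dual certificate in (i) and the extremal sequence in
  -- (ii).
  have hcosn : ∀ n : ℕ, 2 ≤ n → IsPosDefSeq (fun k => Real.cos (k * (Real.pi / (2 * (n : ℝ))))) ∧
      Real.cos ((n : ℤ) * (Real.pi / (2 * (n : ℝ)))) = 0 ∧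
      0 < Real.cos (Real.pi / (2 * (n : ℝ))) := fun n hn => by
    have hn' : (2 : ℝ) ≤ n := by exact_mod_cast hn
    refine ⟨.cos_mul _, ?_, Real.cos_pos_of_mem_Ioo ⟨?_, ?_⟩⟩
    · rw [Int.cast_natCast, show (n : ℝ) * (Real.pi / (2 * n)) = Real.pi / 2 by field_simp,
        Real.cos_pi_div_two]
    · have : 0 < Real.pi / (2 * (n : ℝ)) := by positivity
      linarith
    · exact div_lt_div_of_pos_left hpi two_pos (by linarith)
  refine ⟨fun n hn h => ?_, fun n hn h => ?_, fun n hn h => ?_, fun h => ?_, fun h => ?_⟩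
  · obtain ⟨b, hb, hb0, hb1, hbk⟩ := exists_isPosDefSeq_singleton hn
    obtain ⟨hc, hcn, hc1⟩ := hcosn n hn
    rw [← hb1]
    refine pointwiseExtremum_eq_of_dual hopen hsymm h0 hz hz0 hb hb0
      (fun k hk hkz => hbk k hk (by simpa [h] using hkz)) hc (by simp) (fun k hk => ?_)
      (by simpa using hc1) ?_
    · rw [h] at hk
      obtain rfl : k = n := hk
      exact hcn
    · rw [hb1]
      simp only [Int.cast_one, one_mul]
      field_simp
  · obtain ⟨b, hb, hb0, hb1, hbk⟩ := exists_isPosDefSeq_singleton hn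
    obtain ⟨hc, hcn, hc1⟩ := hcosn n hn
    have := pointwiseExtremum_eq_of_dual hopen hsymm h0 hz hz0 hc (by simp)
      (fun k hk hkz => ?_) hb hb0 (fun k hk => ?_) (by rw [hb1]; positivity) ?_
    · simpa using this
    · obtain rfl : k = n := by
        by_contra hne
        exact hkz (h ▸ ⟨hk, hne⟩)
      exact hcn
    · rw [h] at hk
      exact hbk k hk.1 hk.2
    · rw [hb1]
      simp only [Int.cast_one, one_mul]
      field_simp
  · obtain ⟨b, hb, hb0, hb1, hbk⟩ := exists_isPosDefSeq_gap hn
    rw [← hb1]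
    refine pointwiseExtremum_eq_of_isPosDefSeq hopen hsymm h0 hz hz0 hb hb0
      (fun k hk hkz => hbk k hk ?_) fun a ha ha0 hak => ?_
    · by_contra hlt
      exact hkz (h ▸ ⟨hk, not_le.1 hlt⟩)
    · rw [hb1]
      refine ha.apply_one_le_of_gap ha0 hn fun k hk hkn => hak k hk ?_
      rw [h]
      exact fun hk' => absurd hk'.2 (not_lt.2 hkn)
  all_goals
    obtain ⟨b, hb, hb0, hb1, hbk⟩ := exists_isPosDefSeq_odd
    obtain ⟨c, hc, hc0, hc1, hck⟩ := exists_isPosDefSeq_even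
  · rw [← hb1]
    refine pointwiseExtremum_eq_of_dual hopen hsymm h0 hz hz0 hb hb0
      (fun k hk hkz => hbk k hk fun ho => hkz (h ▸ ⟨hk, ho⟩)) hc hc0 (fun k hk => ?_)
      (by rw [hc1]; positivity) (by rw [hb1, hc1]; field_simp; norm_num)
    rw [h] at hk
    exact hck k hk.1 (Nat.not_even_iff_odd.2 hk.2)
  · rw [← hc1]
    refine pointwiseExtremum_eq_of_dual hopen hsymm h0 hz hz0 hc hc0
      (fun k hk hkz => hck k hk fun ho => hkz (h ▸ ⟨hk, ho⟩)) hb hb0 (fun k hk => ?_)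
      (by rw [hb1]; positivity) (by rw [hb1, hc1]; field_simp; norm_num)
    rw [h] at hk
    exact hbk k hk.1 (Nat.not_odd_iff_even.2 hk.2)
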